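/- For each $m\ge 1$ let $X_{ij}$, $1\le i\le m$, $1\le j\le n$, be independent with $X_{ij}\sim N(\mu_i,1)$, where $n=n_m\ge 2$ and the means $\mu_i=\mu_i^{(m)}$ may depend on $m$. Consider testing $H_i:\mu_i=0$ against $\mu_i\ne 0$ for $i=1,\dots,m$. Put $S_{n,i}=\sum_{j=1}^n X_{ij}^2$ and $T_{n,i}=\sqrt n\,\overline X_{n,i}/\hat\sigma_{n,i}$, where $\overline X_{n,i}$ is the sample mean and $\hat\sigma_{n,i}^2$ the unbiased sample variance of the $i$-th sample. Fix $0<\alpha<1$ and $0<\gamma\le 1$. The two-stage procedure selects $H_i$ if $S_{n,i}\ge \chi_n^2(1-m^{\gamma-1})$, and rejects $H_i$ if it is selected and $|T_{n,i}|\ge t_{n-1}\bigl(1-\frac{\alpha}{2|\hat S_n|}\bigr)$, where $\hat S_n$ is the set of selected indices and $\chi_n^2(p)$, $t_{n-1}(p)$ are the $p$-quantiles of the chi-squared law with $n$ and of the $t$-law with $n-1$ degrees of freedom (with $\chi^2_n(0)=0$). Theorem 3.1. Assume that $\frac{\log m}{n}\to d$ as $m\to\infty$, with $0\le d<\infty$,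 and that the number of false hypotheses satisfies $|\{i\le m:\mu_i\neq 0\}|\asymp m^{1-\epsilon}$ for some $0<\epsilon\le 1$. Let $H_1$ be false with a mean $\mu_1\ne 0$ that does not depend on $m$. (i) If $\epsilon+\gamma\ge 1$ and $\mu_1^2>\max\{e^{2\gamma d}-1,\;2(1-\gamma)d+2\sqrt{(1-\gamma)d}\}$, then $\lim_{m\to\infty}P\{H_1\text{ is rejected}\}=1$. (ii) If $\mu_1^2<\max\{e^{2\gamma d}-1,\;2(1-\gamma)d+\tfrac14\sqrt{(1-\gamma)d}\}$, and moreover $(1-\gamma)d\le 560$ or $\mu_1^2<e^{2\gamma d}-1$, then $\lim_{m\to\infty}P\{H_1\text{ is rejected}\}=0$. -/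

import Mathlib

open MeasureTheory ProbabilityTheory Filter Topology Asymptotics

noncomputable section

namespace TwoStage

/-- The chi-squared distribution with `n` degrees of freedom: the law of the sum of the squares of
`n` independent standard normal variables. -/
def chiSq (n : ℕ) : Measure ℝ :=
  (Measure.pi fun _ : Fin n => gaussianReal 0 1).map fun z => ∑ j, z j ^ 2

/-- Student's `t`-distribution with `k ≥ 1` degrees of freedom: the law of `Z / √(W / k)` with `Z`
standard normal, `W` chi-squared with `k` degrees of freedom, and `Z`, `W` independent. -/
def studentT (k : ℕ) : Measure ℝ :=
  ((gaussianReal 0 1).prod (chiSq k)).map fun zw => zw.1 / √(zw.2 / (k : ℝ))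

/-- The `p`-quantile of a law `ν` on the line, for `0 ≤ p < 1`. For the continuous laws above, whose
distribution function increases strictly on the support, this is the only `x` with
`ν (-∞, x] = p` when `0 < p < 1`. The strict inequality makes the `0`-quantile the left
end of the support, so that it is `0` for the chi-squared laws. -/
def quantile (ν : Measure ℝ) (p : ℝ) : ℝ :=
  sInf {x : ℝ | p < ν.real (Set.Iic x)}

/-- `m` mutually independent samples, each consisting of `n` independent observations, the `i`-th
one from `N(μ i, 1)`; the observations are `X i j` with `1 ≤ i ≤ m` and `1 ≤ j ≤ n`. -/
structure IsGaussianSamples {Ω : Type*} [MeasurableSpace Ω] (P : Measure Ω)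
    (m n : ℕ) (μ : ℕ → ℝ) (X : ℕ → ℕ → Ω → ℝ) : Prop where
  hasLaw : ∀ i ∈ Finset.Icc 1 m, ∀ j ∈ Finset.Icc 1 n, HasLaw (X i j) (gaussianReal (μ i) 1) P
  indep : iIndepFun
    (fun p : ↥(Finset.Icc 1 m ×ˢ Finset.Icc 1 n) => X p.1.1 p.1.2) P

/-- The number of false hypotheses among `H_1, …, H_m`, where `H_i` states that `μ i = 0`. -/
def numFalse (m : ℕ) (μ : ℕ → ℝ) : ℕ :=
  {i ∈ Finset.Icc 1 m | μ i ≠ 0}.card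

/-! In the following, `x i j` with `1 ≤ i ≤ m` and `1 ≤ j ≤ n` are the observed data. -/

/-- The selection statistic: the sum of squares of a sample. -/
def sumSq (n : ℕ) (y : ℕ → ℝ) : ℝ :=
  ∑ j ∈ Finset.Icc 1 n, y j ^ 2

/-- The sample mean. -/
def sampleMean (n : ℕ) (y : ℕ → ℝ) : ℝ :=
  (∑ j ∈ Finset.Icc 1 n, y j) / (n : ℝ)

/-- The unbiased sample variance (for `n ≥ 2`). -/
def sampleVar (n : ℕ) (y : ℕ → ℝ) : ℝ :=
  (∑ j ∈ Finset.Icc 1 n, (y j - sampleMean n y) ^ 2) / ((n : ℝ) - 1)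

/-- The detection statistic: the `t`-statistic of a sample. -/
def tStat (n : ℕ) (y : ℕ → ℝ) : ℝ :=
  √(n : ℝ) * sampleMean n y / √(sampleVar n y)

/-- The selection threshold: the `1 - β` quantile of the chi-squared law with `n` degrees of freedom,
where `β = m ^ (γ - 1)`. -/
def selThreshold (γ : ℝ) (m n : ℕ) : ℝ :=
  quantile (chiSq n) (1 - (m : ℝ) ^ (γ - 1))

/-- The indices of the hypotheses selected in the first stage. -/
def selected (γ : ℝ) (m n : ℕ) (x : ℕ → ℕ → ℝ) : Finset ℕ :=
  {i ∈ Finset.Icc 1 m | selThreshold γ m n ≤ sumSq n (x i)}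

/-- `H_i` is rejected by the two-stage procedure at level `α`: it is selected in the first stage, and
the two-sided Bonferroni `t`-test among the selected hypotheses rejects it in the second stage. -/
def Rejects (α γ : ℝ) (m n : ℕ) (x : ℕ → ℕ → ℝ) (i : ℕ) : Prop :=
  i ∈ selected γ m n x ∧
    quantile (studentT (n - 1)) (1 - α / (2 * ((selected γ m n x).card : ℝ))) ≤ |tStat n (x i)|

/-- The probability that `H_i` is rejected. -/
def rejectProb {Ω : Type*} [MeasurableSpace Ω] (P : Measure Ω) (α γ : ℝ) (m n : ℕ)
    (X : ℕ → ℕ → Ω → ℝ) (i : ℕ) : ℝ :=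
  P.real {ω | Rejects α γ m n (fun k j => X k j ω) i}

end TwoStage

end

namespace TwoStage

/-! ### The chi-squared law -/

/-! By the weak law, the sample mean and `sumSq / n` tend to `μ₁` and `1 + μ₁²`, so the scaled
statistics of `H_1` are asymptotically constant: `S / n → 1 + μ₁²` and `T² / (n - 1) → μ₁²`. It
remains to locate both thresholds on these scales.

Selection: the chi-squared tail beyond `n a` has exponential rate `I(a) = (a - 1 - log a) / 2`, so
the threshold is about `n a*` with `I(a*) = x`, where `x = (1 - γ) d`. The upper bound for the tail
is Chernoff's (`chiSq_real_Ici_le`), the lower one a tilting argument (`exp_le_chiSq_real_Ici`).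
Since `a* - 1 = 2 x + log a*`, the explicit expressions in the theorem come from bounding a
logarithm (`lt_rate_of_lt`, `rate_lt_of_lt`).

Detection: the `t` tail beyond `√k y` is `(1 + y²) ^ (-k / 2)` to exponential order. If about `m ^
γ` hypotheses are selected, the squared critical value is about `(n - 1) (exp (2 γ d) - 1)`.
Markov's inequality bounds the number selected from above: true nulls contribute `m ^ γ` on average,
false ones `O(m ^ (1 - ε))`, which is no more when `ε + γ ≥ 1`. Chebyshev's inequality for the nulls
alone bounds it from below.

The bounds on `t` quantiles are uniform in the number selected, so a union bound over bad events
suffices and the dependence between that number and the data of `H_1` is immaterial. -/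

lemma measurable_sum_sq (n : ℕ) : Measurable fun z : Fin n → ℝ => ∑ j, z j ^ 2 := by
  fun_prop

instance isProbabilityMeasure_chiSq (n : ℕ) : IsProbabilityMeasure (chiSq n) :=
  Measure.isProbabilityMeasure_map (measurable_sum_sq n).aemeasurable

lemma chiSq_Iio_zero (n : ℕ) : chiSq n (Set.Iio 0) = 0 := by
  rw [chiSq, Measure.map_apply (measurable_sum_sq n) measurableSet_Iio]
  convert! measure_empty (μ := Measure.pi fun _ : Fin n => gaussianReal 0 1)
  ext z
  simpa using Finset.sum_nonneg fun j _ => sq_nonneg (z j)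

lemma ae_nonneg_chiSq (n : ℕ) : ∀ᵐ w ∂chiSq n, 0 ≤ w := by
  rw [ae_iff]
  convert! chiSq_Iio_zero n using 2
  ext w
  simp

lemma integral_exp_mul_sq_gaussianReal {l : ℝ} (hl : l < 1 / 2) :
    ∫ z, Real.exp (l * z ^ 2) ∂gaussianReal 0 1 = (√(1 - 2 * l))⁻¹ := by
  have h : ∀ z : ℝ, gaussianPDFReal 0 1 z • Real.exp (l * z ^ 2)
      = (√(2 * Real.pi))⁻¹ * Real.exp (-(1 / 2 - l) * z ^ 2) := by
    intro z
    simp only [gaussianPDFReal, NNReal.coe_one, mul_one, sub_zero, smul_eq_mul]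
    rw [mul_assoc, ← Real.exp_add]
    ring_nf
  rw [integral_gaussianReal_eq_integral_smul one_ne_zero]
  simp_rw [h]
  rw [integral_const_mul, integral_gaussian, ← Real.sqrt_inv, ← Real.sqrt_inv,
    ← Real.sqrt_mul (by positivity)]
  congr 1
  have h1 : 1 - 2 * l ≠ 0 := by linarith
  have h2 : 1 / 2 - l ≠ 0 := by linarith
  have := Real.pi_ne_zero
  field_simp

lemma integral_exp_mul_chiSq (n : ℕ) {l : ℝ} (hl : l < 1 / 2) :
    ∫ w, Real.exp (l * w) ∂chiSq n = Real.exp (-(n / 2 * Real.log (1 - 2 * l))) := by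
  rw [chiSq, integral_map (measurable_sum_sq n).aemeasurable
    (by fun_prop : Continuous fun w : ℝ => Real.exp (l * w)).aestronglyMeasurable]
  simp_rw [Finset.mul_sum, Real.exp_sum]
  rw [integral_fintype_prod_eq_prod (𝕜 := ℝ) (fun (_ : Fin n) z => Real.exp (l * z ^ 2))]
  simp_rw [integral_exp_mul_sq_gaussianReal hl]
  have h0 : 0 < 1 - 2 * l := by linarith
  rw [Finset.prod_const, Finset.card_univ, Fintype.card_fin,
    ← Real.exp_log (show 0 < (√(1 - 2 * l))⁻¹ by positivity), ← Real.exp_nat_mul, Real.log_inv,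
    Real.log_sqrt h0.le]
  ring_nf

lemma integrable_exp_mul_chiSq (n : ℕ) {l : ℝ} (hl : l < 1 / 2) :
    Integrable (fun w => Real.exp (l * w)) (chiSq n) :=
  -- A non-integrable function has integral `0` by convention, whereas this one is positive.
  not_imp_comm.1 integral_undef (by rw [integral_exp_mul_chiSq n hl]; positivity)

/-- The Chernoff bound for the upper tail of the chi-squared law. -/
lemma chiSq_real_Ici_le (n : ℕ) {a : ℝ} (ha : 1 ≤ a) :
    (chiSq n).real (Set.Ici (n * a)) ≤ Real.exp (-(n * ((a - 1 - Real.log a) / 2))) := by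
  have ha0 : 0 < a := by linarith
  -- This `l` minimises the exponent `-l a - log (1 - 2 l) / 2`.
  have hl : (1 - a⁻¹) / 2 < 1 / 2 := by
    have : 0 < a⁻¹ := by positivity
    linarith
  have hl0 : 0 ≤ (1 - a⁻¹) / 2 := by
    have : a⁻¹ ≤ 1 := inv_le_one_of_one_le₀ ha
    linarith
  have := measure_ge_le_exp_mul_mgf (X := id) (μ := chiSq n) (n * a) hl0
    (integrable_exp_mul_chiSq n hl)
  refine this.trans (le_of_eq ?_)
  simp only [mgf, id]
  rw [integral_exp_mul_chiSq n hl, ← Real.exp_add,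
    show 1 - 2 * ((1 - a⁻¹) / 2) = a⁻¹ by ring, Real.log_inv]
  congr 1
  field_simp
  ring

/-- The exponential lower bound for the upper tail of the chi-squared law, by a change of measure:
under the law tilted by `l = (1 - b⁻¹) / 2` the mean is `n * b`. -/
lemma exp_le_chiSq_real_Ici (n : ℕ) {a b c s : ℝ} (hb : 1 ≤ b) (hs : 0 ≤ s)
    (hsb : 2 * s * b < 1) :
    Real.exp (n / 2 * Real.log b) * (1
      - Real.exp (n * (s * a - Real.log (1 + 2 * s * b) / 2))
      - Real.exp (n * (-(s * c) - Real.log (1 - 2 * s * b) / 2)))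
      ≤ Real.exp (n * ((1 - b⁻¹) / 2 * c)) * (chiSq n).real (Set.Ici (n * a)) := by
  have hb0 : 0 < b := by linarith
  have hbi : b⁻¹ ≤ 1 := inv_le_one_of_one_le₀ hb
  have hbi0 : 0 < b⁻¹ := by positivity
  have hsb' : 2 * s < b⁻¹ := by
    rw [← one_div, lt_div_iff₀ hb0]
    exact hsb
  set l := (1 - b⁻¹) / 2 with hl
  have hlb : 1 - 2 * l = b⁻¹ := by rw [hl]; ring
  have hl0 : 0 ≤ l := by rw [hl]; linarith
  have h1 : l < 1 / 2 := by linarith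
  have h2 : l - s < 1 / 2 := by linarith
  have h3 : l + s < 1 / 2 := by linarith
  -- The two outer ranges `w < n a` and `w > n c` cost a factor `exp (± s ...)`; between them `exp
  -- (l w) ≤ exp (l n c)`. For `a < b < c` and small `s` the outer terms are negligible under the
  -- tilted law.
  have hpt : ∀ w : ℝ, Real.exp (l * w) ≤ Real.exp (s * (n * a)) * Real.exp ((l - s) * w)
      + Real.exp (-(s * (n * c))) * Real.exp ((l + s) * w)
      + (Set.Ici (n * a)).indicator (fun _ => Real.exp (l * (n * c))) w := by
    intro w
    have e1 := Real.exp_pos (s * (n * a) + (l - s) * w)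
    have e2 := Real.exp_pos (-(s * (n * c)) + (l + s) * w)
    rw [← Real.exp_add, ← Real.exp_add]
    by_cases hw : n * a ≤ w
    · rw [Set.indicator_of_mem (by exact hw)]
      have e3 := Real.exp_pos (l * (n * c))
      rcases le_total w (n * c) with hwc | hwc
      · have : Real.exp (l * w) ≤ Real.exp (l * (n * c)) :=
          Real.exp_le_exp.2 (mul_le_mul_of_nonneg_left hwc hl0)
        linarith
      · have : Real.exp (l * w) ≤ Real.exp (-(s * (n * c)) + (l + s) * w) :=
          Real.exp_le_exp.2 (by nlinarith)
        linarith
    · rw [Set.indicator_of_notMem (by simpa using hw)]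
      have : Real.exp (l * w) ≤ Real.exp (s * (n * a) + (l - s) * w) :=
        Real.exp_le_exp.2 (by push Not at hw; nlinarith)
      linarith
  have i2 := (integrable_exp_mul_chiSq n h2).const_mul (Real.exp (s * (n * a)))
  have i3 := (integrable_exp_mul_chiSq n h3).const_mul (Real.exp (-(s * (n * c))))
  have i4 : Integrable ((Set.Ici (n * a)).indicator fun _ : ℝ => Real.exp (l * (n * c)))
      (chiSq n) := (integrable_const _).indicator measurableSet_Ici
  have key := integral_mono (integrable_exp_mul_chiSq n h1) ((i2.add i3).add i4) hpt
  have i23 : Integrable (fun x => Real.exp (s * (n * a)) * Real.exp ((l - s) * x) +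
      Real.exp (-(s * (n * c))) * Real.exp ((l + s) * x)) (chiSq n) := i2.add i3
  simp only [Pi.add_apply] at key
  rw [integral_add i23 i4, integral_add i2 i3, integral_const_mul,
    integral_const_mul, integral_exp_mul_chiSq n h1, integral_exp_mul_chiSq n h2,
    integral_exp_mul_chiSq n h3, integral_indicator_const _ measurableSet_Ici, hlb,
    show 1 - 2 * (l - s) = b⁻¹ * (1 + 2 * s * b) by rw [hl]; field_simp; ring,
    show 1 - 2 * (l + s) = b⁻¹ * (1 - 2 * s * b) by rw [hl]; field_simp; ring,
    Real.log_mul (by positivity) (by positivity), Real.log_mul (by positivity) (by linarith),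
    Real.log_inv, ← Real.exp_add, ← Real.exp_add, smul_eq_mul] at key
  rw [mul_sub, mul_sub, ← Real.exp_add, ← Real.exp_add]
  ring_nf at key ⊢
  linarith

/-- Given the other coordinates, the first can take at most two values. Zero degrees of freedom are
excluded: that law is a point mass at `0`. -/
lemma chiSq_singleton (n : ℕ) (c : ℝ) : chiSq (n + 1) {c} = 0 := by
  rw [chiSq, Measure.map_apply (measurable_sum_sq _) (measurableSet_singleton c)]
  have hp := measurePreserving_piFinSuccAbove (fun _ : Fin (n + 1) => gaussianReal 0 1) 0
  have hm' : MeasurableSet {x : ℝ × (Fin n → ℝ) | x.1 ^ 2 + ∑ j, x.2 j ^ 2 = c} :=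
    measurableSet_eq_fun (by fun_prop) measurable_const
  have : (fun z : Fin (n + 1) → ℝ => ∑ j, z j ^ 2) ⁻¹' {c}
      = MeasurableEquiv.piFinSuccAbove (fun _ => ℝ) 0 ⁻¹'
        {x : ℝ × (Fin n → ℝ) | x.1 ^ 2 + ∑ j, x.2 j ^ 2 = c} := by
    ext z
    simp [Fin.sum_univ_succ, Fin.tail]
  rw [this, hp.measure_preimage hm'.nullMeasurableSet, Measure.prod_apply_symm hm']
  refine lintegral_eq_zero_of_ae_eq_zero (Eventually.of_forall fun y => ?_)
  have := nullSingletonClass_gaussianReal (μ := 0) one_ne_zero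
  refine measure_mono_null (t := {√(c - ∑ j, y j ^ 2), -√(c - ∑ j, y j ^ 2)}) ?_
    (Set.Finite.measure_zero (Set.toFinite _) _)
  intro x hx
  have hx' : x ^ 2 = c - ∑ j, y j ^ 2 := eq_sub_of_add_eq hx
  rw [← hx', Real.sqrt_sq_eq_abs]
  rcases abs_choice x with h | h <;> simp [h]

/-! ### Quantiles -/

section Quantile

variable {ν : Measure ℝ} [IsProbabilityMeasure ν] {p : ℝ}

lemma quantile_set_nonempty (hp : p < 1) : {x : ℝ | p < ν.real (Set.Iic x)}.Nonempty := by
  have := (tendsto_cdf_atTop ν).eventually (lt_mem_nhds hp)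
  obtain ⟨x, hx⟩ := this.exists
  exact ⟨x, by simpa [cdf_eq_real] using hx⟩

lemma quantile_set_bddBelow (hp : 0 < p) : BddBelow {x : ℝ | p < ν.real (Set.Iic x)} := by
  have := (tendsto_cdf_atBot ν).eventually (gt_mem_nhds hp)
  obtain ⟨x, hx⟩ := this.exists
  refine ⟨x, fun y hy => ?_⟩
  by_contra! hlt
  have := monotone_cdf ν hlt.le
  rw [cdf_eq_real, cdf_eq_real] at *
  exact absurd hy (by simp only [Set.mem_ofPred_eq]; linarith)

lemma le_quantile {t : ℝ} (hp : p < 1) (h : 1 - p ≤ ν.real (Set.Ici t)) : t ≤ quantile ν p := by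
  refine le_csInf (quantile_set_nonempty hp) fun x hx => ?_
  by_contra! hlt
  have h1 : ν.real (Set.Iic x) ≤ ν.real (Set.Ici t)ᶜ :=
    measureReal_mono fun y hy => by simpa using lt_of_le_of_lt hy hlt
  rw [probReal_compl_eq_one_sub measurableSet_Ici] at h1
  have : p < ν.real (Set.Iic x) := hx
  linarith

lemma quantile_le {t : ℝ} (hb : BddBelow {x : ℝ | p < ν.real (Set.Iic x)})
    (h : ν.real (Set.Ioi t) < 1 - p) : quantile ν p ≤ t := by
  refine csInf_le hb ?_
  rw [← Set.compl_Iic, probReal_compl_eq_one_sub measurableSet_Iic] at h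
  simp only [Set.mem_ofPred_eq]
  linarith

/-- Strictly below the infimum the distribution function is at most `p`; exhausting the open
half-line by closed ones keeps this bound. -/
lemma le_measureReal_Ici_quantile (hb : BddBelow {x : ℝ | p < ν.real (Set.Iic x)}) :
    1 - p ≤ ν.real (Set.Ici (quantile ν p)) := by
  rw [← Set.compl_Iio, probReal_compl_eq_one_sub measurableSet_Iio]
  obtain ⟨u, hu, -, hlim⟩ := exists_seq_strictMono_tendsto' (show quantile ν p - 1 < quantile ν p by
    linarith)
  have hU : Set.Iio (quantile ν p) = ⋃ i, Set.Iic (u i) := by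
    ext x
    simp only [Set.mem_Iio, Set.mem_iUnion, Set.mem_Iic]
    refine ⟨fun hx => ?_, fun ⟨i, hi⟩ => ?_⟩
    · exact ((hlim.eventually (lt_mem_nhds hx)).exists).imp fun i hi => hi.le
    · exact hi.trans_lt ((hu (Nat.lt_succ_self i)).trans_le (hu.monotone.ge_of_tendsto hlim _))
  have hle : ∀ i, ν (Set.Iic (u i)) ≤ ENNReal.ofReal p := by
    intro i
    have hi : u i < quantile ν p :=
      (hu (Nat.lt_succ_self i)).trans_le (hu.monotone.ge_of_tendsto hlim _)
    have := notMem_of_lt_csInf hi hb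
    simp only [Set.mem_ofPred_eq, not_lt] at this
    rw [← ofReal_measureReal]
    exact ENNReal.ofReal_le_ofReal this
  have h1 : ν (Set.Iio (quantile ν p)) ≤ ENNReal.ofReal p := by
    rw [hU, Directed.measure_iUnion]
    · exact iSup_le hle
    · exact (monotone_nat_of_le_succ fun i => Set.Iic_subset_Iic.2
        (hu.monotone i.le_succ)).directed_le
  have h0 : 0 ≤ p ∨ p < 0 := le_or_gt 0 p
  rcases h0 with h0 | h0
  · have := ENNReal.toReal_mono ENNReal.ofReal_ne_top h1
    rw [ENNReal.toReal_ofReal h0] at this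
    rw [measureReal_def]
    linarith
  · exact absurd hb fun ⟨x, hx⟩ => by
      have := hx (show x - 1 ∈ _ from lt_of_lt_of_le h0 measureReal_nonneg)
      linarith

lemma measureReal_Ioi_quantile_le (hp : p < 1) : ν.real (Set.Ioi (quantile ν p)) ≤ 1 - p := by
  rw [← Set.compl_Iic, probReal_compl_eq_one_sub measurableSet_Iic]
  have hr : Tendsto (cdf ν) (𝓝[>] quantile ν p) (𝓝 (cdf ν (quantile ν p))) :=
    ((cdf ν).right_continuous _).mono_left (nhdsWithin_mono _ Set.Ioi_subset_Ici_self)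
  have : p ≤ cdf ν (quantile ν p) := by
    refine ge_of_tendsto hr ?_
    filter_upwards [self_mem_nhdsWithin] with x hx
    obtain ⟨y, hy, hyx⟩ := exists_lt_of_csInf_lt (quantile_set_nonempty (ν := ν) hp) hx
    have h1 := monotone_cdf ν hyx.le
    have h2 : p < ν.real (Set.Iic y) := hy
    rw [← cdf_eq_real] at h2
    linarith
  rw [cdf_eq_real] at this
  linarith

end Quantile

/-- The value `p = 0` is included because it is the selection level when `γ = 1`. -/
lemma chiSq_quantile_set_bddBelow (n : ℕ) {p : ℝ} (hp : 0 ≤ p) :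
    BddBelow {x : ℝ | p < (chiSq n).real (Set.Iic x)} := by
  refine ⟨0, fun x hx => ?_⟩
  by_contra! hlt
  have : chiSq n (Set.Iic x) = 0 :=
    measure_mono_null (fun y hy => lt_of_le_of_lt hy hlt) (chiSq_Iio_zero n)
  simp only [Set.mem_ofPred_eq, measureReal_def, this, ENNReal.toReal_zero] at hx
  linarith

/-! ### Tails of the normal law and of the `t`-law -/

lemma gaussianReal_Ici_le {u : ℝ} (hu : 0 ≤ u) :
    gaussianReal 0 1 (Set.Ici u) ≤ ENNReal.ofReal (Real.exp (-(u ^ 2 / 2))) := by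
  have := measure_ge_le_exp_mul_mgf (X := id) (μ := gaussianReal 0 1) u hu
    (integrable_exp_mul_gaussianReal u)
  rw [mgf_id_gaussianReal, ← Real.exp_add] at this
  rw [← ofReal_measureReal]
  refine ENNReal.ofReal_le_ofReal (this.trans (le_of_eq ?_))
  congr 1
  simp
  ring

/-- The density on `[u, u + 1]` is at least its value at `u + 1`, and `(u + 1)² ≤ (1 + δ) u² + 1 +
δ⁻¹`. A pure square in the exponent lets the chi-squared transform integrate the bound. -/
lemma le_gaussianReal_Ici {u δ : ℝ} (hu : 0 ≤ u) (hδ : 0 < δ) :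
    ENNReal.ofReal ((√(2 * Real.pi))⁻¹ * Real.exp (-((1 + δ⁻¹) / 2))
      * Real.exp (-((1 + δ) * u ^ 2 / 2))) ≤ gaussianReal 0 1 (Set.Ici u) := by
  calc _ ≤ ENNReal.ofReal (gaussianPDFReal 0 1 (u + 1)) := by
        refine ENNReal.ofReal_le_ofReal ?_
        simp only [gaussianPDFReal, NNReal.coe_one, mul_one, sub_zero]
        rw [mul_assoc, ← Real.exp_add]
        gcongr
        have h : 0 ≤ δ⁻¹ * (δ * u - 1) ^ 2 := by positivity
        have : δ⁻¹ * (δ * u - 1) ^ 2 = δ * u ^ 2 - 2 * u + δ⁻¹ := by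
          field_simp
          ring
        rw [this] at h
        linarith
    _ = ∫⁻ _ in Set.Icc u (u + 1), gaussianPDF 0 1 (u + 1) := by
        simp [gaussianPDF]
    _ ≤ ∫⁻ x in Set.Icc u (u + 1), gaussianPDF 0 1 x := by
        refine setLIntegral_mono (measurable_gaussianPDF 0 1) fun x hx => ?_
        refine ENNReal.ofReal_le_ofReal ?_
        simp only [gaussianPDFReal, NNReal.coe_one, mul_one, sub_zero]
        have : x ^ 2 ≤ (u + 1) ^ 2 := pow_le_pow_left₀ (hu.trans hx.1) hx.2 2
        gcongr
    _ ≤ ∫⁻ x in Set.Ici u, gaussianPDF 0 1 x :=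
        lintegral_mono_set Set.Icc_subset_Ici_self
    _ = _ := (gaussianReal_apply 0 one_ne_zero _).symm

lemma measurable_studentT (k : ℕ) : Measurable fun zw : ℝ × ℝ => zw.1 / √(zw.2 / (k : ℝ)) := by
  fun_prop

instance isProbabilityMeasure_studentT (k : ℕ) : IsProbabilityMeasure (studentT k) :=
  Measure.isProbabilityMeasure_map (measurable_studentT k).aemeasurable

lemma studentT_Ici (k : ℕ) (t : ℝ) :
    studentT k (Set.Ici t) = ∫⁻ w, gaussianReal 0 1 {z | t ≤ z / √(w / k)} ∂chiSq k := by
  rw [studentT, Measure.map_apply (measurable_studentT k) measurableSet_Ici,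
    Measure.prod_apply_symm (measurable_studentT k measurableSet_Ici)]
  rfl

lemma lintegral_exp_mul_chiSq (k : ℕ) {C l : ℝ} (hC : 0 ≤ C) (hl : l < 1 / 2) :
    ∫⁻ w, ENNReal.ofReal (C * Real.exp (l * w)) ∂chiSq k
      = ENNReal.ofReal (C * Real.exp (-(k / 2 * Real.log (1 - 2 * l)))) := by
  rw [← ofReal_integral_eq_lintegral_ofReal ((integrable_exp_mul_chiSq k hl).const_mul C)
    (Eventually.of_forall fun w => by positivity), integral_const_mul, integral_exp_mul_chiSq k hl]

/-- Given `W = w` the event is `Z ≥ y √w`, of probability at most `exp (-y² w / 2)`; averaging over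
`w` gives `(1 + y²) ^ (-k / 2)`. -/
lemma studentT_real_Ici_le {k : ℕ} (hk : 0 < k) {y : ℝ} (hy : 0 < y) :
    (studentT k).real (Set.Ici (√k * y)) ≤ Real.exp (-(k / 2 * Real.log (1 + y ^ 2))) := by
  refine ENNReal.toReal_le_of_le_ofReal (Real.exp_pos _).le ?_
  have hkR : (0 : ℝ) < k := by exact_mod_cast hk
  rw [studentT_Ici]
  have hl := lintegral_exp_mul_chiSq k zero_le_one (l := -(y ^ 2 / 2)) (by nlinarith)
  rw [one_mul, show 1 - 2 * -(y ^ 2 / 2) = 1 + y ^ 2 by ring] at hl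
  rw [← hl]
  refine lintegral_mono_ae ?_
  filter_upwards [ae_nonneg_chiSq k] with w hw
  refine le_trans (measure_mono fun z hz => ?_) ((gaussianReal_Ici_le
    (show 0 ≤ y * √w by positivity)).trans (le_of_eq ?_))
  · have hz : √k * y ≤ z / √(w / k) := hz
    rw [Real.sqrt_div hw] at hz
    -- At `w = 0` the quotient is `0` by convention, below the positive level.
    have hs : 0 < √w := by
      by_contra h0
      have h0 : √w = 0 := le_antisymm (not_lt.1 h0) (Real.sqrt_nonneg _)
      rw [h0, zero_div, div_zero] at hz
      have : 0 < √k * y := by positivity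
      linarith
    rw [le_div_iff₀ (by positivity)] at hz
    have e : √k * y * (√w / √k) = y * √w := by field_simp
    rwa [e] at hz
  · rw [one_mul, mul_pow, Real.sq_sqrt hw]
    ring_nf

lemma le_studentT_real_Ici {k : ℕ} (hk : 0 < k) {y δ : ℝ} (hy : 0 < y) (hδ : 0 < δ) :
    (√(2 * Real.pi))⁻¹ * Real.exp (-((1 + δ⁻¹) / 2))
      * Real.exp (-(k / 2 * Real.log (1 + (1 + δ) * y ^ 2)))
      ≤ (studentT k).real (Set.Ici (√k * y)) := by
  refine (ENNReal.ofReal_le_iff_le_toReal (measure_ne_top _ _)).1 ?_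
  have hkR : (0 : ℝ) < k := by exact_mod_cast hk
  rw [studentT_Ici]
  have hl := lintegral_exp_mul_chiSq k (C := (√(2 * Real.pi))⁻¹ * Real.exp (-((1 + δ⁻¹) / 2)))
    (by positivity) (l := -((1 + δ) * y ^ 2 / 2)) (by nlinarith [mul_pos hδ (pow_pos hy 2)])
  rw [show 1 - 2 * -((1 + δ) * y ^ 2 / 2) = 1 + (1 + δ) * y ^ 2 by ring] at hl
  rw [← hl]
  refine lintegral_mono_ae ?_
  have hpos : ∀ᵐ w ∂chiSq k, w ≠ 0 := by
    rw [ae_iff]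
    obtain ⟨k, rfl⟩ := Nat.exists_eq_succ_of_ne_zero hk.ne'
    simpa using chiSq_singleton k 0
  filter_upwards [ae_nonneg_chiSq k, hpos] with w hw hw0
  have hw : 0 < w := lt_of_le_of_ne hw (Ne.symm hw0)
  refine le_trans (le_of_eq ?_) ((le_gaussianReal_Ici
    (show 0 ≤ y * √w by positivity) hδ).trans (measure_mono fun z hz => ?_))
  · rw [mul_pow, Real.sq_sqrt hw.le]
    ring_nf
  · have hz : y * √w ≤ z := hz
    rw [Set.mem_ofPred_eq, Real.sqrt_div hw.le, le_div_iff₀ (by positivity)]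
    have e : √k * y * (√w / √k) = y * √w := by field_simp
    rwa [e]

/-! ### Asymptotics of the thresholds -/

lemma tendsto_sampleSize {n : ℕ → ℕ} {d : ℝ}
    (hlim : Tendsto (fun m : ℕ => Real.log (m : ℝ) / (n m : ℝ)) atTop (𝓝 d)) (hn : ∀ m, 2 ≤ n m) :
    Tendsto (fun m => (n m : ℝ)) atTop atTop := by
  have hlog : Tendsto (fun m : ℕ => Real.log (m : ℝ)) atTop atTop :=
    Real.tendsto_log_atTop.comp tendsto_natCast_atTop_atTop
  have hd : 0 < |d| + 1 := by positivity
  refine tendsto_atTop_mono' _ ?_ (hlog.atTop_div_const hd)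
  filter_upwards [hlim.eventually (gt_mem_nhds (show d < |d| + 1 by linarith [le_abs_self d]))]
    with m hm
  have h0 : (0 : ℝ) < n m := by exact_mod_cast (by linarith [hn m] : 0 < n m)
  rw [div_lt_iff₀ h0] at hm
  rw [div_le_iff₀ hd]
  linarith

lemma tendsto_log_div_pred {n : ℕ → ℕ} {d : ℝ}
    (hlim : Tendsto (fun m : ℕ => Real.log (m : ℝ) / (n m : ℝ)) atTop (𝓝 d)) (hn : ∀ m, 2 ≤ n m) :
    Tendsto (fun m : ℕ => Real.log (m : ℝ) / ((n m - 1 : ℕ) : ℝ)) atTop (𝓝 d) := by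
  have hN := tendsto_sampleSize hlim hn
  have h1 : Tendsto (fun m : ℕ => (1 - (n m : ℝ)⁻¹)⁻¹) atTop (𝓝 1) := by
    simpa using ((tendsto_const_nhds (x := (1 : ℝ))).sub hN.inv_tendsto_atTop).inv₀ (by simp)
  have h2 := hlim.mul h1
  rw [mul_one] at h2
  refine h2.congr fun m => ?_
  have h0 : (2 : ℝ) ≤ n m := by exact_mod_cast hn m
  have : (n m : ℝ) - 1 ≠ 0 := by linarith
  have : (n m : ℝ) ≠ 0 := by linarith
  rw [Nat.cast_sub (by linarith [hn m]), Nat.cast_one]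
  field_simp

/-- Reduces a comparison of exponents to one of their limiting rates; the additive constant `C`
absorbs all fixed prefactors. -/
lemma eventually_mul_add_lt_mul {u N : ℕ → ℝ} {d A B : ℝ}
    (hlim : Tendsto (fun m => u m / N m) atTop (𝓝 d)) (hN : Tendsto N atTop atTop)
    (h : A * d < B) (C : ℝ) : ∀ᶠ m in atTop, A * u m + C < B * N m := by
  have h1 : Tendsto (fun m => A * (u m / N m) + C * (N m)⁻¹) atTop (𝓝 (A * d + C * 0)) :=
    (hlim.const_mul A).add (hN.inv_tendsto_atTop.const_mul C)
  filter_upwards [h1.eventually (gt_mem_nhds (show A * d + C * 0 < B by linarith)),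
    hN.eventually_gt_atTop 0] with m hm h0
  have := mul_lt_mul_of_pos_right hm h0
  convert! this using 1
  field_simp

lemma eventually_mul_lt_mul_sub {u N : ℕ → ℝ} {d A B : ℝ}
    (hlim : Tendsto (fun m => u m / N m) atTop (𝓝 d)) (hN : Tendsto N atTop atTop)
    (h : B < A * d) (C : ℝ) : ∀ᶠ m in atTop, B * N m + C < A * u m := by
  filter_upwards [eventually_mul_add_lt_mul hlim hN (show -A * d < -B by linarith) C] with m hm
  linarith

lemma natCast_rpow_eq_exp {m : ℕ} (hm : 1 ≤ m) (r : ℝ) :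
    (m : ℝ) ^ r = Real.exp (r * Real.log m) := by
  rw [Real.rpow_def_of_pos (by exact_mod_cast hm), mul_comm]

section Thresholds

variable {n : ℕ → ℕ} {d γ α : ℝ}

lemma one_sub_rpow_nonneg (hγ : γ ≤ 1) {m : ℕ} (hm : 1 ≤ m) : 0 ≤ 1 - (m : ℝ) ^ (γ - 1) :=
  sub_nonneg.2 (Real.rpow_le_one_of_one_le_of_nonpos (by exact_mod_cast hm) (by linarith))

lemma one_sub_rpow_lt_one {m : ℕ} (hm : 1 ≤ m) : 1 - (m : ℝ) ^ (γ - 1) < 1 := by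
  have : (0 : ℝ) < m := by exact_mod_cast hm
  linarith [Real.rpow_pos_of_pos this (γ - 1)]

lemma eventually_selThreshold_le
    (hlim : Tendsto (fun m : ℕ => Real.log (m : ℝ) / (n m : ℝ)) atTop (𝓝 d)) (hn : ∀ m, 2 ≤ n m)
    (hγ : γ ≤ 1) {a : ℝ} (ha : 1 ≤ a) (h : (1 - γ) * d < (a - 1 - Real.log a) / 2) :
    ∀ᶠ m in atTop, selThreshold γ m (n m) ≤ n m * a := by
  filter_upwards [eventually_mul_add_lt_mul hlim (tendsto_sampleSize hlim hn) h 0,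
    eventually_ge_atTop 1] with m hm h1
  refine quantile_le (chiSq_quantile_set_bddBelow _ (one_sub_rpow_nonneg hγ h1)) ?_
  have h2 : (chiSq (n m)).real (Set.Ioi (n m * a)) ≤ _ :=
    (measureReal_mono Set.Ioi_subset_Ici_self).trans (chiSq_real_Ici_le (n m) ha)
  refine h2.trans_lt ?_
  rw [sub_sub_cancel, natCast_rpow_eq_exp h1, Real.exp_lt_exp]
  linarith

lemma eventually_le_selThreshold
    (hlim : Tendsto (fun m : ℕ => Real.log (m : ℝ) / (n m : ℝ)) atTop (𝓝 d)) (hn : ∀ m, 2 ≤ n m)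
    {a : ℝ} (ha : 1 ≤ a) (h : (a - 1 - Real.log a) / 2 < (1 - γ) * d) :
    ∀ᶠ m in atTop, n m * a ≤ selThreshold γ m (n m) := by
  have hN := tendsto_sampleSize hlim hn
  -- The tilted mean is `b = a + η` and the upper cut-off `c = a + 2 η`; at `η = 0` the cost is
  -- exactly the rate at `a`.
  obtain ⟨η, hη, hη0⟩ : ∃ η : ℝ, (1 - (a + η)⁻¹) / 2 * (a + 2 * η) - Real.log (a + η) / 2
      < (1 - γ) * d ∧ 0 < η := by
    have hc : ContinuousAt (fun η : ℝ => (1 - (a + η)⁻¹) / 2 * (a + 2 * η)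
        - Real.log (a + η) / 2) 0 := by
      have : a + 0 ≠ 0 := by linarith
      fun_prop (disch := assumption)
    have h0 : (1 - (a + 0)⁻¹) / 2 * (a + 2 * 0) - Real.log (a + 0) / 2 < (1 - γ) * d := by
      have e : (1 - (a + 0)⁻¹) / 2 * (a + 2 * 0) = (a - 1) / 2 := by
        rw [add_zero, mul_zero, add_zero]
        field_simp
      rw [e, add_zero]
      linarith
    have := (hc.eventually (gt_mem_nhds h0)).filter_mono (nhdsWithin_le_nhds (s := Set.Ioi 0))
    exact (this.and self_mem_nhdsWithin).exists
  set b := a + η with hb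
  set c := a + 2 * η with hc
  have hb1 : 1 ≤ b := by linarith
  obtain ⟨s, ⟨h1, h2, h3⟩, h4⟩ : ∃ s : ℝ, (a * (1 + 2 * s * b) < b ∧ b < c * (1 - 2 * s * b) ∧
      2 * s * b < 1) ∧ 0 < s := by
    have e1 : ∀ᶠ s : ℝ in 𝓝 0, a * (1 + 2 * s * b) < b :=
      (by fun_prop : Continuous fun s : ℝ => a * (1 + 2 * s * b)).continuousAt.eventually
        (gt_mem_nhds (by simp only [mul_zero, zero_mul]; linarith))
    have e2 : ∀ᶠ s : ℝ in 𝓝 0, b < c * (1 - 2 * s * b) :=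
      (by fun_prop : Continuous fun s : ℝ => c * (1 - 2 * s * b)).continuousAt.eventually
        (lt_mem_nhds (by simp only [mul_zero, zero_mul]; linarith))
    have e3 : ∀ᶠ s : ℝ in 𝓝 0, 2 * s * b < 1 :=
      (by fun_prop : Continuous fun s : ℝ => 2 * s * b).continuousAt.eventually
        (gt_mem_nhds (by simp only [mul_zero, zero_mul]; linarith))
    have := (e1.and (e2.and e3)).filter_mono (nhdsWithin_le_nhds (s := Set.Ioi 0))
    exact (this.and self_mem_nhdsWithin).exists
  have k1 : s * a - Real.log (1 + 2 * s * b) / 2 < 0 := by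
    have hp : 0 < 1 + 2 * s * b := by positivity
    have := Real.one_sub_inv_le_log_of_pos hp
    have e : 1 - (1 + 2 * s * b)⁻¹ = 2 * s * (b / (1 + 2 * s * b)) := by field_simp; ring
    have h5 : a < b / (1 + 2 * s * b) := by rwa [lt_div_iff₀ hp]
    nlinarith
  have k2 : -(s * c) - Real.log (1 - 2 * s * b) / 2 < 0 := by
    have hp : 0 < 1 - 2 * s * b := by linarith
    have := Real.one_sub_inv_le_log_of_pos hp
    have e : 1 - (1 - 2 * s * b)⁻¹ = -(2 * s * (b / (1 - 2 * s * b))) := by field_simp; ring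
    have h5 : b / (1 - 2 * s * b) < c := by rwa [div_lt_iff₀ hp]
    nlinarith
  -- Two errors below `1 / 4` leave tilted mass at least `1 / 2`, whence the constant `log 2` below.
  have t1 : ∀ κ < 0, ∀ᶠ m in atTop, Real.exp (n m * κ) < 1 / 4 := fun κ hκ =>
    (Real.tendsto_exp_atBot.comp (hN.atTop_mul_const_of_neg hκ)).eventually
      (gt_mem_nhds (by norm_num))
  filter_upwards [eventually_mul_lt_mul_sub hlim hN hη (Real.log 2), eventually_ge_atTop 1,
    t1 _ k1, t1 _ k2] with m hm hm1 hm2 hm3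
  refine le_quantile (one_sub_rpow_lt_one hm1) ?_
  have key := exp_le_chiSq_real_Ici (n m) (a := a) (c := c) hb1 h4.le h3
  have key2 : Real.exp (n m / 2 * Real.log b) * (1 / 2)
      ≤ Real.exp (n m * ((1 - b⁻¹) / 2 * c)) * (chiSq (n m)).real (Set.Ici (n m * a)) :=
    le_trans (mul_le_mul_of_nonneg_left (by linarith) (Real.exp_pos _).le) key
  rw [sub_sub_cancel, natCast_rpow_eq_exp hm1]
  have h6 : Real.exp ((γ - 1) * Real.log m) * Real.exp (n m * ((1 - b⁻¹) / 2 * c))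
      ≤ Real.exp (n m / 2 * Real.log b) * (1 / 2) := by
    have : (1 / 2 : ℝ) = Real.exp (-Real.log 2) := by
      rw [Real.exp_neg, Real.exp_log two_pos, one_div]
    rw [this, ← Real.exp_add, ← Real.exp_add, Real.exp_le_exp]
    linarith
  exact le_of_mul_le_mul_left ((mul_comm _ _).trans_le (h6.trans key2)) (Real.exp_pos _)

/-- The bound is uniform in `N`, since `N` will be the random number of selected hypotheses. -/
lemma eventually_quantile_studentT_le (hα : 0 < α ∧ α < 1)
    (hlim : Tendsto (fun m : ℕ => Real.log (m : ℝ) / (n m : ℝ)) atTop (𝓝 d)) (hn : ∀ m, 2 ≤ n m)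
    {r y : ℝ} (hy : 0 < y) (h : 2 * r * d < Real.log (1 + y ^ 2)) :
    ∀ᶠ m : ℕ in atTop, ∀ N : ℕ, 1 ≤ N → (N : ℝ) ≤ (m : ℝ) ^ r →
      quantile (studentT (n m - 1)) (1 - α / (2 * (N : ℝ))) ≤ √((n m - 1 : ℕ) : ℝ) * y := by
  have hk : Tendsto (fun m => ((n m - 1 : ℕ) : ℝ)) atTop atTop := by
    refine (tendsto_atTop_add_const_right _ (-1) (tendsto_sampleSize hlim hn)).congr fun m => ?_
    rw [Nat.cast_sub (by linarith [hn m])]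
    simp [sub_eq_add_neg]
  filter_upwards [eventually_mul_add_lt_mul (tendsto_log_div_pred hlim hn) hk
    (show r * d < Real.log (1 + y ^ 2) / 2 by linarith) (-Real.log (α / 2)),
    eventually_ge_atTop 1] with m hm hm1 N hN hNr
  have hN1 : (1 : ℝ) ≤ N := by exact_mod_cast hN
  have hp : 0 < 1 - α / (2 * (N : ℝ)) := by
    rw [sub_pos, div_lt_one (by positivity)]
    linarith [hα.2]
  refine quantile_le (quantile_set_bddBelow hp) ?_
  refine ((measureReal_mono Set.Ioi_subset_Ici_self).trans
    (studentT_real_Ici_le (by have := hn m; omega) hy)).trans_lt ?_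
  rw [sub_sub_cancel]
  have : Real.exp (-(r * Real.log m)) * (α / 2) ≤ α / (2 * N) := by
    rw [Real.exp_neg, ← natCast_rpow_eq_exp hm1, inv_mul_eq_div, div_div]
    have := hα.1
    gcongr
  refine lt_of_lt_of_le ?_ this
  rw [← Real.exp_log (half_pos hα.1), ← Real.exp_add, Real.exp_lt_exp]
  linarith

lemma eventually_le_quantile_studentT (hα : 0 < α ∧ α < 1)
    (hlim : Tendsto (fun m : ℕ => Real.log (m : ℝ) / (n m : ℝ)) atTop (𝓝 d)) (hn : ∀ m, 2 ≤ n m)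
    {r y : ℝ} (hy : 0 < y) (h : Real.log (1 + y ^ 2) < 2 * r * d) :
    ∀ᶠ m : ℕ in atTop, ∀ N : ℕ, (m : ℝ) ^ r ≤ N →
      √((n m - 1 : ℕ) : ℝ) * y ≤ quantile (studentT (n m - 1)) (1 - α / (2 * (N : ℝ))) := by
  have hk : Tendsto (fun m => ((n m - 1 : ℕ) : ℝ)) atTop atTop := by
    refine (tendsto_atTop_add_const_right _ (-1) (tendsto_sampleSize hlim hn)).congr fun m => ?_
    rw [Nat.cast_sub (by linarith [hn m])]
    simp [sub_eq_add_neg]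
  obtain ⟨δ, hδ, hδ0⟩ : ∃ δ : ℝ, Real.log (1 + (1 + δ) * y ^ 2) < 2 * r * d ∧ 0 < δ := by
    have hc : ContinuousAt (fun δ : ℝ => Real.log (1 + (1 + δ) * y ^ 2)) 0 := by
      have : 1 + (1 + 0) * y ^ 2 ≠ 0 := by positivity
      fun_prop (disch := assumption)
    have h0 : Real.log (1 + (1 + 0) * y ^ 2) < 2 * r * d := by simpa using h
    have := (hc.eventually (gt_mem_nhds h0)).filter_mono (nhdsWithin_le_nhds (s := Set.Ioi 0))
    exact (this.and self_mem_nhdsWithin).exists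
  set C := (√(2 * Real.pi))⁻¹ * Real.exp (-((1 + δ⁻¹) / 2)) with hC
  have hC0 : 0 < C := by positivity
  filter_upwards [eventually_mul_lt_mul_sub (tendsto_log_div_pred hlim hn) hk
    (show Real.log (1 + (1 + δ) * y ^ 2) / 2 < r * d by linarith)
    (Real.log (α / 2) - Real.log C), eventually_ge_atTop 1] with m hm hm1 N hNr
  have hm0 : (0 : ℝ) < (m : ℝ) ^ r := Real.rpow_pos_of_pos (by exact_mod_cast hm1) r
  have hN1 : (0 : ℝ) < N := by linarith
  have hα0 := hα.1
  refine le_quantile (sub_lt_self _ (by positivity)) ?_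
  refine le_trans ?_ (le_studentT_real_Ici (by have := hn m; omega) hy hδ0)
  rw [sub_sub_cancel, ← hC]
  have : α / (2 * N) ≤ Real.exp (-(r * Real.log m)) * (α / 2) := by
    rw [Real.exp_neg, ← natCast_rpow_eq_exp hm1, inv_mul_eq_div, div_div]
    gcongr
  refine this.trans ?_
  rw [← Real.exp_log (half_pos hα.1), ← Real.exp_log hC0, ← Real.exp_add, ← Real.exp_add,
    Real.exp_le_exp]
  linarith

end Thresholds

/-! ### The weak law of large numbers and the laws of the statistics -/

lemma measureReal_abs_sum_sub_ge_le {Ω ι : Type*} [MeasurableSpace Ω] {P : Measure Ω}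
    [IsProbabilityMeasure P] {Y : ι → Ω → ℝ} {s : Finset ι} (hY : ∀ i ∈ s, MemLp (Y i) 2 P)
    (hind : Set.Pairwise ↑s fun i j => IndepFun (Y i) (Y j) P) {e v : ℝ}
    (he : ∀ i ∈ s, ∫ ω, Y i ω ∂P = e) (hv : ∀ i ∈ s, Var[Y i; P] ≤ v) {c : ℝ} (hc : 0 < c) :
    P.real {ω | c ≤ |∑ i ∈ s, Y i ω - s.card * e|} ≤ s.card * v / c ^ 2 := by
  have hsum : MemLp (∑ i ∈ s, Y i) 2 P := memLp_finsetSum' s hY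
  have hE : ∫ ω, (∑ i ∈ s, Y i) ω ∂P = s.card * e := by
    simp only [Finset.sum_apply]
    rw [integral_finsetSum s fun i hi => (hY i hi).integrable one_le_two, Finset.sum_congr rfl he,
      Finset.sum_const, nsmul_eq_mul]
  have hV : Var[∑ i ∈ s, Y i; P] ≤ s.card * v := by
    rw [IndepFun.variance_sum hY hind, ← nsmul_eq_mul]
    exact Finset.sum_le_card_nsmul _ _ _ hv
  have h := meas_ge_le_variance_div_sq hsum hc
  rw [hE] at h
  simp only [Finset.sum_apply] at h
  have h0 := variance_nonneg (∑ i ∈ s, Y i) P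
  refine (ENNReal.toReal_le_of_le_ofReal (by positivity) h).trans ?_
  gcongr

lemma memLp_sq_gaussianReal (a : ℝ) : MemLp (fun x : ℝ => x ^ 2) 2 (gaussianReal a 1) := by
  have h := (memLp_id_gaussianReal (μ := a) (v := 1) 4)
  have h2 := h.norm_rpow_div 2
  have e : ((4 : NNReal) : ENNReal) / 2 = 2 := by
    rw [show ((4 : NNReal) : ENNReal) = 2 * 2 by norm_num,
      ENNReal.mul_div_cancel_right two_ne_zero (by simp)]
  rw [e] at h2
  simpa using h2

lemma integral_sq_gaussianReal (a : ℝ) : ∫ x, x ^ 2 ∂gaussianReal a 1 = a ^ 2 + 1 := by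
  have h := variance_eq_sub (memLp_id_gaussianReal (μ := a) (v := 1) 2)
  rw [variance_id_gaussianReal] at h
  simp only [Pi.pow_apply, id, integral_id_gaussianReal, NNReal.coe_one] at h
  linarith

lemma sum_Icc_one_eq_sum_fin (n : ℕ) (f : ℕ → ℝ) :
    ∑ j ∈ Finset.Icc 1 n, f j = ∑ j : Fin n, f (j + 1) := by
  rw [Fin.sum_univ_eq_sum_range (fun j => f (j + 1)) n, Finset.range_eq_Ico,
    Finset.sum_Ico_add' f 0 n 1]
  rfl

namespace IsGaussianSamples

variable {Ω : Type*} [MeasurableSpace Ω] {P : Measure Ω} {m n : ℕ}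
  {μ : ℕ → ℝ} {X : ℕ → ℕ → Ω → ℝ}

lemma indepFun_obs (h : IsGaussianSamples P m n μ X) {i : ℕ} (hi : i ∈ Finset.Icc 1 m) :
    Set.Pairwise ↑(Finset.Icc 1 n) fun j j' => IndepFun (X i j) (X i j') P := by
  intro j hj j' hj' hne
  exact h.indep.indepFun (i := ⟨(i, j), Finset.mk_mem_product hi hj⟩)
    (j := ⟨(i, j'), Finset.mk_mem_product hi hj'⟩) fun e => hne (by
      simpa using congrArg (fun p => p.1.2) e)

lemma hasLaw_sumSq (h : IsGaussianSamples P m n μ X) {i : ℕ} (hi : i ∈ Finset.Icc 1 m)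
    (hμ : μ i = 0) : HasLaw (fun ω => sumSq n fun j => X i j ω) (chiSq n) P := by
  have hmem : ∀ j : Fin n, (j : ℕ) + 1 ∈ Finset.Icc 1 n := fun j => by
    simp only [Finset.mem_Icc]
    omega
  have hind : iIndepFun (fun (j : Fin n) => X i (j + 1)) P :=
    h.indep.precomp (g := fun j : Fin n => ⟨(i, (j : ℕ) + 1), Finset.mk_mem_product hi (hmem j)⟩)
      fun j j' e => by simpa [Fin.ext_iff] using e
  have hl := hind.hasLaw_pi (μ := fun _ => gaussianReal 0 1)
    fun j => hμ ▸ h.hasLaw i hi _ (hmem j)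
  have hsq : HasLaw (fun z : Fin n → ℝ => ∑ j, z j ^ 2) (chiSq n)
      (Measure.pi fun _ : Fin n => gaussianReal 0 1) :=
    ⟨(measurable_sum_sq n).aemeasurable, rfl⟩
  simpa only [sumSq, sum_Icc_one_eq_sum_fin] using hsq.fun_comp hl

lemma aemeasurable_sumSq (h : IsGaussianSamples P m n μ X) {i : ℕ} (hi : i ∈ Finset.Icc 1 m) :
    AEMeasurable (fun ω => sumSq n fun j => X i j ω) P := by
  simp only [sumSq]
  exact Finset.aemeasurable_fun_sum _ fun j hj => (h.hasLaw i hi j hj).aemeasurable.pow_const 2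

lemma indepFun_sumSq (h : IsGaussianSamples P m n μ X) :
    Set.Pairwise ↑(Finset.Icc 1 m) fun i i' =>
      IndepFun (fun ω => sumSq n fun j => X i j ω) (fun ω => sumSq n fun j => X i' j ω) P := by
  intro i hi i' hi' hne
  let S (i : ℕ) : Finset ↥(Finset.Icc 1 m ×ˢ Finset.Icc 1 n) := {p | p.1.1 = i}
  have hd : Disjoint (S i) (S i') := by
    refine Finset.disjoint_left.2 fun p hp hp' => hne ?_
    simp only [S, Finset.mem_filter_univ] at hp hp'
    exact hp.symm.trans hp'
  have hm : ∀ p : ↥(Finset.Icc 1 m ×ˢ Finset.Icc 1 n), AEMeasurable (X p.1.1 p.1.2) P :=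
    fun p => (h.hasLaw _ (Finset.mem_product.1 p.2).1 _ (Finset.mem_product.1 p.2).2).aemeasurable
  have key := h.indep.indepFun_finset₀ (S i) (S i') hd hm
  have hsum : ∀ k ∈ Finset.Icc 1 m, (fun ω => sumSq n fun j => X k j ω)
      = (fun z : S k → ℝ => ∑ p, z p ^ 2) ∘ fun ω (p : S k) => X p.1.1.1 p.1.1.2 ω := by
    intro k hk
    ext ω
    simp only [sumSq, Function.comp_apply]
    rw [Finset.sum_coe_sort (S k) fun p => X p.1.1 p.1.2 ω ^ 2]
    refine Finset.sum_bij (fun j hj => ⟨(k, j), Finset.mk_mem_product hk hj⟩) ?_ ?_ ?_ ?_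
    · simp [S]
    · simp
    · rintro ⟨⟨a, b⟩, hp⟩ hb
      simp only [S, Finset.mem_filter_univ] at hb
      subst hb
      exact ⟨b, (Finset.mem_product.1 hp).2, rfl⟩
    · simp
  rw [hsum i hi, hsum i' hi']
  exact key.comp (by fun_prop) (by fun_prop)

lemma integral_selection (h : IsGaussianSamples P m n μ X) (q : ℝ) {i : ℕ}
    (hi : i ∈ Finset.Icc 1 m) (hμ : μ i = 0) :
    ∫ ω, (Set.Ici q).indicator (1 : ℝ → ℝ) (sumSq n fun j => X i j ω) ∂P
      = (chiSq n).real (Set.Ici q) := by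
  rw [← integral_indicator_one measurableSet_Ici]
  exact (h.hasLaw_sumSq hi hμ).integral_comp
    (measurable_one.indicator measurableSet_Ici).aestronglyMeasurable

variable [IsProbabilityMeasure P]

lemma measureReal_abs_sum_comp_sub_ge_le (h : IsGaussianSamples P m n μ X) {i : ℕ}
    (hi : i ∈ Finset.Icc 1 m) {f : ℝ → ℝ} (hf : Measurable f)
    (hfL : MemLp f 2 (gaussianReal (μ i) 1)) {c : ℝ} (hc : 0 < c) :
    P.real {ω | c ≤ |∑ j ∈ Finset.Icc 1 n, f (X i j ω) - n * ∫ x, f x ∂gaussianReal (μ i) 1|}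
      ≤ n * Var[f; gaussianReal (μ i) 1] / c ^ 2 := by
  have key := measureReal_abs_sum_sub_ge_le (P := P) (Y := fun j ω => f (X i j ω))
    (s := Finset.Icc 1 n) (e := ∫ x, f x ∂gaussianReal (μ i) 1)
    (v := Var[f; gaussianReal (μ i) 1]) ?_ ?_ ?_ ?_ hc
  · simpa using key
  · intro j hj
    have hl := h.hasLaw i hi j hj
    have := hfL
    rw [← hl.map_eq] at this
    exact this.comp_of_map hl.aemeasurable
  · exact fun j hj j' hj' hne => (h.indepFun_obs hi hj hj' hne).comp hf hf
  · exact fun j hj => (h.hasLaw i hi j hj).integral_comp hf.aestronglyMeasurable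
  · intro j hj
    have hl := h.hasLaw i hi j hj
    rw [← hl.map_eq, variance_map hf.aemeasurable hl.aemeasurable]
    rfl

lemma memLp_selection (h : IsGaussianSamples P m n μ X) (q : ℝ) {i : ℕ}
    (hi : i ∈ Finset.Icc 1 m) :
    MemLp (fun ω => (Set.Ici q).indicator (1 : ℝ → ℝ) (sumSq n fun j => X i j ω)) 2 P := by
  refine memLp_of_bounded (a := 0) (b := 1) (Eventually.of_forall fun ω => ?_) ?_ 2
  · exact ⟨Set.indicator_nonneg (by simp) _, Set.indicator_le_self' (by simp) _⟩
  · exact ((measurable_one.indicator measurableSet_Ici).comp_aemeasurable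
      (h.aemeasurable_sumSq hi)).aestronglyMeasurable

lemma card_selected_eq_sum (γ : ℝ) (m n : ℕ) (x : ℕ → ℕ → ℝ) :
    ((selected γ m n x).card : ℝ) = ∑ i ∈ Finset.Icc 1 m,
      (Set.Ici (selThreshold γ m n)).indicator (1 : ℝ → ℝ) (sumSq n (x i)) := by
  rw [selected, Finset.card_filter]
  push_cast
  exact Finset.sum_congr rfl fun i _ => by simp [Set.indicator_apply]

lemma measureReal_le_card_selected_le (h : IsGaussianSamples P m n μ X) {γ : ℝ} (hm : 1 ≤ m)
    (hn : 1 ≤ n) {K : ℝ} (hK : 0 < K) :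
    P.real {ω | K ≤ ((selected γ m n fun k j => X k j ω).card : ℝ)}
      ≤ (numFalse m μ + (m : ℝ) ^ γ) / K := by
  set q := selThreshold γ m n with hq
  have hL := fun i (hi : i ∈ Finset.Icc 1 m) => (h.memLp_selection q hi).integrable one_le_two
  have hsel := measureReal_Ioi_quantile_le (ν := chiSq n) (one_sub_rpow_lt_one (γ := γ) hm)
  -- Selection uses the closed half-line while the quantile controls the open one; the law has no
  -- atoms.
  have hIci : (chiSq n).real (Set.Ici q) ≤ (m : ℝ) ^ (γ - 1) := by
    obtain ⟨k, rfl⟩ := Nat.exists_eq_succ_of_ne_zero (show n ≠ 0 by omega)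
    have : chiSq (k + 1) (Set.Ici q) ≤ chiSq (k + 1) {q} + chiSq (k + 1) (Set.Ioi q) := by
      rw [← Set.Ioi_union_left, Set.union_comm]
      exact measure_union_le _ _
    rw [chiSq_singleton, zero_add] at this
    rw [sub_sub_cancel] at hsel
    exact (ENNReal.toReal_mono (measure_ne_top _ _) this).trans hsel
  have hmk := mul_meas_ge_le_integral_of_nonneg (μ := P)
    (f := fun ω => ((selected γ m n fun k j => X k j ω).card : ℝ))
    (Eventually.of_forall fun ω => by positivity) (by
      simp only [card_selected_eq_sum]
      exact integrable_finsetSum _ hL) K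
  rw [le_div_iff₀' hK]
  refine hmk.trans ?_
  simp only [card_selected_eq_sum]
  rw [integral_finsetSum _ hL, ← Finset.sum_filter_add_sum_filter_not _ fun i => μ i ≠ 0]
  refine add_le_add ?_ ?_
  · rw [numFalse, ← mul_one (Finset.card _ : ℝ), ← nsmul_eq_mul]
    refine Finset.sum_le_card_nsmul _ _ _ fun i hi => ?_
    refine (integral_mono (hL i (Finset.mem_filter.1 hi).1) (integrable_const 1)
      fun ω => Set.indicator_le_self' (by simp) _).trans (by simp)
  · have h1 : ∀ i ∈ {i ∈ Finset.Icc 1 m | ¬ μ i ≠ 0},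
        ∫ ω, (Set.Ici q).indicator (1 : ℝ → ℝ) (sumSq n fun j => X i j ω) ∂P
          ≤ (m : ℝ) ^ (γ - 1) := by
      intro i hi
      rw [Finset.mem_filter, not_not] at hi
      rw [h.integral_selection q hi.1 hi.2]
      exact hIci
    refine (Finset.sum_le_card_nsmul _ _ _ h1).trans ?_
    have hm0 : (0 : ℝ) < m := by exact_mod_cast hm
    have hc : (({i ∈ Finset.Icc 1 m | ¬ μ i ≠ 0}.card : ℕ) : ℝ) ≤ m := by
      exact_mod_cast (Finset.card_filter_le _ _).trans (by simp)
    rw [nsmul_eq_mul]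
    calc _ ≤ (m : ℝ) * (m : ℝ) ^ (γ - 1) := by gcongr
      _ = (m : ℝ) ^ γ := by
        rw [Real.rpow_sub_one hm0.ne']
        field_simp

/-- Chebyshev for the nulls alone: at least `m / 2` of them, each selected with probability `p ≥ m ^
(γ - 1)`. An indicator's variance is at most its mean, so deviating by half the mean has probability
at most `4 / (s.card * p)`. -/
lemma measureReal_card_selected_lt_le (h : IsGaussianSamples P m n μ X) {γ : ℝ} (hγ : γ ≤ 1)
    (hm : 1 ≤ m) (hF : (numFalse m μ : ℝ) ≤ m / 2) :
    P.real {ω | ((selected γ m n fun k j => X k j ω).card : ℝ) < (m : ℝ) ^ γ / 4}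
      ≤ 8 / (m : ℝ) ^ γ := by
  set q := selThreshold γ m n with hq
  set s : Finset ℕ := {i ∈ Finset.Icc 1 m | ¬ μ i ≠ 0} with hs
  set p := (chiSq n).real (Set.Ici q) with hp
  have hm0 : (0 : ℝ) < m := by exact_mod_cast hm
  have hmγ : 0 < (m : ℝ) ^ γ := Real.rpow_pos_of_pos hm0 _
  have hmem : ∀ i ∈ s, i ∈ Finset.Icc 1 m ∧ μ i = 0 := fun i hi => by
    rwa [hs, Finset.mem_filter, not_not] at hi
  have hpβ : (m : ℝ) ^ (γ - 1) ≤ p := by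
    have := le_measureReal_Ici_quantile (ν := chiSq n)
      (chiSq_quantile_set_bddBelow n (one_sub_rpow_nonneg hγ hm))
    rwa [sub_sub_cancel] at this
  have hcard : (m : ℝ) / 2 ≤ s.card := by
    have := Finset.card_filter_add_card_filter_not (s := Finset.Icc 1 m) fun i => μ i ≠ 0
    rw [Nat.card_Icc, Nat.add_sub_cancel] at this
    have : (numFalse m μ : ℝ) + s.card = m := by exact_mod_cast this
    linarith
  have hmean : (m : ℝ) ^ γ / 2 ≤ s.card * p := by
    calc _ = (m : ℝ) / 2 * (m : ℝ) ^ (γ - 1) := by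
          rw [Real.rpow_sub_one hm0.ne']
          field_simp
      _ ≤ _ := by gcongr
  have hL := fun i (hi : i ∈ s) => h.memLp_selection q (hmem i hi).1
  have hE : ∀ i ∈ s, ∫ ω, (Set.Ici q).indicator (1 : ℝ → ℝ) (sumSq n fun j => X i j ω) ∂P = p :=
    fun i hi => h.integral_selection q (hmem i hi).1 (hmem i hi).2
  have key := measureReal_abs_sum_sub_ge_le (P := P) (s := s)
    (Y := fun i ω => (Set.Ici q).indicator (1 : ℝ → ℝ) (sumSq n fun j => X i j ω)) (e := p)
    (v := p) (c := s.card * p / 2) hL ?_ hE ?_ (by linarith)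
  · calc _ ≤ _ := measureReal_mono (fun ω hω => ?_)
      _ ≤ _ := key
      _ = 4 / (s.card * p) := by
        have : s.card * p ≠ 0 := by linarith
        field_simp
        norm_num
      _ ≤ 4 / ((m : ℝ) ^ γ / 2) := by gcongr
      _ = _ := by field_simp; norm_num
    have hω : ((selected γ m n fun k j => X k j ω).card : ℝ) < (m : ℝ) ^ γ / 4 := hω
    rw [card_selected_eq_sum] at hω
    have hle : ∑ i ∈ s, (Set.Ici q).indicator (1 : ℝ → ℝ) (sumSq n fun j => X i j ω)
        ≤ ∑ i ∈ Finset.Icc 1 m, (Set.Ici q).indicator (1 : ℝ → ℝ) (sumSq n fun j => X i j ω) :=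
      Finset.sum_le_sum_of_subset_of_nonneg (Finset.filter_subset _ _)
        fun i _ _ => Set.indicator_nonneg (by simp) _
    show s.card * p / 2 ≤ |_|
    rw [abs_sub_comm]
    refine le_trans ?_ (le_abs_self _)
    linarith
  · intro i hi i' hi' hne
    have hmi : Measurable ((Set.Ici q).indicator (1 : ℝ → ℝ)) :=
      measurable_one.indicator measurableSet_Ici
    exact (h.indepFun_sumSq (hmem i hi).1 (hmem i' hi').1 hne).comp hmi hmi
  · intro i hi
    refine (variance_le_expectation_sq (hL i hi).1).trans_eq ?_
    rw [← hE i hi]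
    refine integral_congr_ae (Eventually.of_forall fun ω => ?_)
    by_cases hω : q ≤ sumSq n fun j => X i j ω <;> simp [Set.indicator_apply, hω]

end IsGaussianSamples

/-! ### The rejection probability -/

lemma card_mul_sampleVar {n : ℕ} (hn : 2 ≤ n) (y : ℕ → ℝ) :
    ((n - 1 : ℕ) : ℝ) * sampleVar n y = n * (sumSq n y / n - sampleMean n y ^ 2) := by
  have h2 : (2 : ℝ) ≤ n := by exact_mod_cast hn
  have h1 : (n : ℝ) - 1 ≠ 0 := by linarith
  have h0 : (n : ℝ) ≠ 0 := by linarith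
  have hs : ∑ j ∈ Finset.Icc 1 n, y j = n * sampleMean n y := by
    rw [sampleMean]
    field_simp
  rw [Nat.cast_sub (by omega), Nat.cast_one, sampleVar, mul_div_cancel₀ _ h1]
  simp only [sub_sq, Finset.sum_add_distrib, Finset.sum_sub_distrib, ← Finset.sum_mul,
    mul_assoc, ← Finset.mul_sum, Finset.sum_const, Nat.card_Icc, Nat.add_sub_cancel, nsmul_eq_mul]
  rw [hs, sumSq]
  field_simp
  ring

lemma sqrt_mul_le_abs_tStat_iff {n : ℕ} (hn : 2 ≤ n) {x : ℕ → ℝ} {y : ℝ} (hy : 0 ≤ y)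
    (hv : 0 < sumSq n x / n - sampleMean n x ^ 2) :
    √((n - 1 : ℕ) : ℝ) * y ≤ |tStat n x| ↔
      y ^ 2 * (sumSq n x / n - sampleMean n x ^ 2) ≤ sampleMean n x ^ 2 := by
  have hn0 : (0 : ℝ) < n := by exact_mod_cast (by omega : 0 < n)
  have hk0 : (0 : ℝ) < (n - 1 : ℕ) := by exact_mod_cast (by omega : 0 < n - 1)
  have hV := card_mul_sampleVar hn x
  have hV0 : 0 < sampleVar n x := by
    by_contra! h
    have := mul_nonpos_of_nonneg_of_nonpos hk0.le h
    have := mul_pos hn0 hv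
    linarith
  rw [← sq_le_sq₀ (by positivity) (abs_nonneg _), sq_abs, tStat, div_pow, mul_pow, mul_pow,
    Real.sq_sqrt hk0.le, Real.sq_sqrt hn0.le, Real.sq_sqrt hV0.le, le_div_iff₀ hV0,
    show ((n - 1 : ℕ) : ℝ) * y ^ 2 * sampleVar n x
      = n * (y ^ 2 * (sumSq n x / n - sampleMean n x ^ 2)) by linear_combination y ^ 2 * hV]
  exact mul_le_mul_iff_right₀ hn0

/-! ### Explicit bounds for the inverse of the chi-squared rate function. -/

/-- With `u = √x / 4` one has `32 u² = 2 x`. Beyond `u = 1` it suffices to compare the exponential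
at the right end of each interval with the quadratic at the left end. -/
lemma exp_lt_of_lt_six {u : ℝ} (hu : 0 < u) (hu6 : u < 6) : Real.exp u < 1 + u + 32 * u ^ 2 := by
  have hk : ∀ k : ℕ, u ≤ k → Real.exp u ≤ 2.7183 ^ k := fun k hk => by
    refine (Real.exp_le_exp.2 hk).trans ?_
    rw [← mul_one (k : ℝ), Real.exp_nat_mul]
    exact pow_le_pow_left₀ (Real.exp_pos _).le (Real.exp_one_lt_d9.le.trans (by norm_num)) k
  rcases le_total u 1 with h1 | h1
  · have := Real.abs_exp_sub_one_sub_id_le (abs_le.2 ⟨by linarith, h1⟩)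
    have := (abs_le.1 this).2
    nlinarith
  rcases le_total u 2 with h2 | h2
  · have := hk 2 (by exact_mod_cast h2)
    norm_num at this
    nlinarith
  rcases le_total u 4 with h4 | h4
  · have := hk 4 (by exact_mod_cast h4)
    norm_num at this
    nlinarith
  · have := hk 6 (by exact_mod_cast hu6.le)
    norm_num at this
    nlinarith

lemma add_sqrt_lt_log {x : ℝ} (hx0 : 0 < x) (hx : x ≤ 560) :
    1 / 4 * √x < Real.log (1 + 2 * x + 1 / 4 * √x) := by
  have hs : 0 < √x := Real.sqrt_pos.2 hx0
  rw [Real.lt_log_iff_exp_lt (by positivity)]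
  -- Here `560 < 24²`, which puts `√x / 4` below `6`. Some bound on `x` is needed, as the logarithm
  -- is eventually smaller than `√x / 4`.
  have h24 : √x < 24 := by
    rw [Real.sqrt_lt' (by norm_num)]
    linarith
  have := exp_lt_of_lt_six (u := 1 / 4 * √x) (by linarith) (by linarith)
  have hsq : √x ^ 2 = x := Real.sq_sqrt hx0.le
  nlinarith

/-- For `c = 1 + 2 s + (2 s)² / 2 ≤ exp (2 s)` the rate is at least `s² = x`. The rate increases
strictly on `[1, ∞)`, so the midpoint of `c` and `1 + μ²` serves as `a`. -/
lemma lt_rate_of_lt {x μ : ℝ} (hx : 0 ≤ x) (h : 2 * x + 2 * √x < μ ^ 2) :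
    ∃ a, 1 ≤ a ∧ a < 1 + μ ^ 2 ∧ x < (a - 1 - Real.log a) / 2 := by
  set s := √x with hs
  have hs0 : 0 ≤ s := Real.sqrt_nonneg _
  have hsq : s ^ 2 = x := Real.sq_sqrt hx
  set a := (1 + (2 * x + 2 * s) + (1 + μ ^ 2)) / 2 with ha
  have ha1 : 1 + 2 * x + 2 * s < a := by linarith
  refine ⟨a, by linarith, by linarith, ?_⟩
  set c := 1 + 2 * x + 2 * s with hc
  have hc1 : 1 ≤ c := by linarith
  have h1 : Real.log c ≤ 2 * s := by
    rw [Real.log_le_iff_le_exp (by linarith)]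
    have := Real.quadratic_le_exp_of_nonneg (show 0 ≤ 2 * s by linarith)
    nlinarith
  have h2 : Real.log a < Real.log c + (a - c) := by
    have h3 : Real.log (a / c) < a / c - 1 := by
      refine Real.log_lt_sub_one_of_pos (by apply div_pos <;> linarith) ?_
      rw [ne_eq, div_eq_one_iff_eq (by linarith)]
      linarith
    rw [Real.log_div (by linarith) (by linarith)] at h3
    have h4 : a / c - 1 ≤ a - c := by
      rw [div_sub_one (by linarith), div_le_iff₀ (by linarith)]
      nlinarith
    linarith
  linarith

lemma rate_lt_of_lt {x μ : ℝ} (hx : 0 ≤ x) (hx' : x ≤ 560)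
    (h : μ ^ 2 < 2 * x + 1 / 4 * √x) :
    ∃ a, 1 ≤ a ∧ 1 + μ ^ 2 < a ∧ (a - 1 - Real.log a) / 2 < x := by
  have hs0 : 0 ≤ √x := Real.sqrt_nonneg _
  refine ⟨1 + 2 * x + 1 / 4 * √x, by linarith, by linarith, ?_⟩
  have hx0 : 0 < x := by
    rcases hx.eq_or_lt with h0 | h0
    · rw [← h0, Real.sqrt_zero] at h
      nlinarith [sq_nonneg μ]
    · exact h0
  have := add_sqrt_lt_log hx0 hx'
  linarith

/-! ### Convergence in probability of the sample moments and of the selection count. -/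

section Limits

variable {Ω : ℕ → Type*} [∀ m, MeasurableSpace (Ω m)] {P : ∀ m, Measure (Ω m)}
  [∀ m, IsProbabilityMeasure (P m)] {n : ℕ → ℕ} {μ : ℕ → ℕ → ℝ} {X : ∀ m, ℕ → ℕ → Ω m → ℝ}

/-- The weak law of large numbers for the mean and the mean square of a sample with fixed mean. -/
lemma tendsto_measureReal_notMem {μ₁ : ℝ}
    (hX : ∀ m, IsGaussianSamples (P m) m (n m) (μ m) (X m)) (hμ : ∀ m, μ m 1 = μ₁)
    (hn : Tendsto (fun m => (n m : ℝ)) atTop atTop) {U : Set (ℝ × ℝ)}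
    (hU : U ∈ 𝓝 (μ₁, 1 + μ₁ ^ 2)) :
    Tendsto (fun m => (P m).real {ω | (sampleMean (n m) (fun j => X m 1 j ω),
      sumSq (n m) (fun j => X m 1 j ω) / n m) ∉ U}) atTop (𝓝 0) := by
  obtain ⟨η, hη, hball⟩ := Metric.mem_nhds_iff.1 hU
  set V := Var[id; gaussianReal μ₁ 1] + Var[fun x => x ^ 2; gaussianReal μ₁ 1] with hV
  have hlim : Tendsto (fun m => V / η ^ 2 * (n m : ℝ)⁻¹) atTop (𝓝 0) := by
    simpa using hn.inv_tendsto_atTop.const_mul (V / η ^ 2)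
  refine tendsto_of_tendsto_of_tendsto_of_le_of_le' tendsto_const_nhds hlim
    (Eventually.of_forall fun m => measureReal_nonneg) ?_
  filter_upwards [hn.eventually_gt_atTop 0, eventually_ge_atTop 1] with m hm hm1
  have hi : 1 ∈ Finset.Icc 1 m := by simpa using hm1
  have hc : 0 < n m * η := by positivity
  have h1 := (hX m).measureReal_abs_sum_comp_sub_ge_le hi measurable_id
    (memLp_id_gaussianReal 2) hc
  have h2 := (hX m).measureReal_abs_sum_comp_sub_ge_le hi (measurable_id.pow_const 2)
    (memLp_sq_gaussianReal (μ m 1)) hc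
  simp only [hμ, id] at h1 h2
  rw [integral_id_gaussianReal] at h1
  rw [integral_sq_gaussianReal] at h2
  calc _ ≤ (P m).real ({ω | n m * η ≤ |∑ j ∈ Finset.Icc 1 (n m), X m 1 j ω - n m * μ₁|} ∪
        {ω | n m * η ≤ |∑ j ∈ Finset.Icc 1 (n m), X m 1 j ω ^ 2 - n m * (μ₁ ^ 2 + 1)|}) := by
        refine measureReal_mono fun ω hω => ?_
        by_contra hcon
        simp only [Set.mem_union, Set.mem_ofPred_eq, not_or, not_le] at hcon
        refine hω (hball ?_)
        have hdiv : ∀ S t : ℝ, |S - n m * t| < n m * η → dist (S / n m) t < η := by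
          intro S t hS
          rw [Real.dist_eq, div_sub' hm.ne', abs_div, abs_of_pos hm, div_lt_iff₀ hm]
          linarith
        rw [Metric.mem_ball, Prod.dist_eq, max_lt_iff, add_comm 1]
        exact ⟨hdiv _ _ hcon.1, hdiv _ _ hcon.2⟩
    _ ≤ _ := measureReal_union_le _ _
    _ ≤ _ := add_le_add h1 h2
    _ = _ := by
      rw [hV]
      field_simp

/-- The number of selected hypotheses is at most `m ^ r` for `r > γ`, up to a vanishing
probability. -/
lemma tendsto_measureReal_le_card_selected {γ r ε : ℝ} (hr : γ < r) (hεγ : 1 ≤ ε + γ)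
    (hn : ∀ m, 2 ≤ n m) (hX : ∀ m, IsGaussianSamples (P m) m (n m) (μ m) (X m))
    (hsparse : (fun m : ℕ => (numFalse m (μ m) : ℝ)) =O[atTop] fun m : ℕ => (m : ℝ) ^ (1 - ε)) :
    Tendsto (fun m => (P m).real {ω | (m : ℝ) ^ r
      ≤ ((selected γ m (n m) fun k j => X m k j ω).card : ℝ)}) atTop (𝓝 0) := by
  obtain ⟨C, hC⟩ := hsparse.bound
  have hlim : Tendsto (fun m : ℕ => (|C| + 1) * (m : ℝ) ^ (-(r - γ))) atTop (𝓝 0) := by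
    simpa using ((tendsto_rpow_neg_atTop (sub_pos.2 hr)).comp
      tendsto_natCast_atTop_atTop).const_mul (|C| + 1)
  refine tendsto_of_tendsto_of_tendsto_of_le_of_le' tendsto_const_nhds hlim
    (Eventually.of_forall fun m => measureReal_nonneg) ?_
  filter_upwards [hC, eventually_ge_atTop 1] with m hm hm1
  have hm0 : (0 : ℝ) < m := by exact_mod_cast hm1
  have hK : 0 < (m : ℝ) ^ r := Real.rpow_pos_of_pos hm0 r
  refine ((hX m).measureReal_le_card_selected_le hm1 (by linarith [hn m]) hK).trans ?_
  rw [Real.norm_of_nonneg (by positivity), Real.norm_of_nonneg (by positivity)] at hm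
  have h1 : (m : ℝ) ^ (1 - ε) ≤ (m : ℝ) ^ γ :=
    Real.rpow_le_rpow_of_exponent_le (by exact_mod_cast hm1) (by linarith)
  have h2 : (numFalse m (μ m) : ℝ) ≤ |C| * (m : ℝ) ^ γ :=
    hm.trans (mul_le_mul (le_abs_self C) h1 (by positivity) (abs_nonneg C))
  rw [neg_sub, Real.rpow_sub hm0, div_le_iff₀ hK]
  calc _ ≤ (|C| + 1) * (m : ℝ) ^ γ := by linarith
    _ = _ := by field_simp

/-- The number of selected hypotheses is at least `m ^ r` for `r < γ`, up to a vanishing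
probability. -/
lemma tendsto_measureReal_card_selected_lt {γ r ε : ℝ} (hγ0 : 0 < γ) (hγ : γ ≤ 1) (hr : r < γ)
    (hε : 0 < ε) (hX : ∀ m, IsGaussianSamples (P m) m (n m) (μ m) (X m))
    (hsparse : (fun m : ℕ => (numFalse m (μ m) : ℝ)) =O[atTop] fun m : ℕ => (m : ℝ) ^ (1 - ε)) :
    Tendsto (fun m => (P m).real {ω | ((selected γ m (n m) fun k j => X m k j ω).card : ℝ)
      < (m : ℝ) ^ r}) atTop (𝓝 0) := by
  obtain ⟨C, hC⟩ := hsparse.bound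
  have hrpow : ∀ t : ℝ, 0 < t → Tendsto (fun m : ℕ => (m : ℝ) ^ t) atTop atTop := fun t ht =>
    (tendsto_rpow_atTop ht).comp tendsto_natCast_atTop_atTop
  have hlim : Tendsto (fun m : ℕ => 8 / (m : ℝ) ^ γ) atTop (𝓝 0) :=
    (hrpow γ hγ0).const_div_atTop 8
  refine tendsto_of_tendsto_of_tendsto_of_le_of_le' tendsto_const_nhds hlim
    (Eventually.of_forall fun m => measureReal_nonneg) ?_
  filter_upwards [hC, eventually_ge_atTop 1, (hrpow ε hε).eventually_ge_atTop (2 * C),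
    (hrpow (γ - r) (sub_pos.2 hr)).eventually_ge_atTop 4] with m hm hm1 hmε hmr
  have hm0 : (0 : ℝ) < m := by exact_mod_cast hm1
  rw [Real.norm_of_nonneg (by positivity), Real.norm_of_nonneg (by positivity)] at hm
  have hF : (numFalse m (μ m) : ℝ) ≤ m / 2 := by
    refine hm.trans ?_
    rw [Real.rpow_sub hm0, Real.rpow_one, ← mul_div_assoc, div_le_iff₀ (by positivity)]
    nlinarith
  refine (measureReal_mono fun ω hω => ?_).trans
    ((hX m).measureReal_card_selected_lt_le hγ hm1 hF)
  have hω : (_ : ℝ) < (m : ℝ) ^ r := hω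
  refine lt_of_lt_of_le hω ?_
  rw [Real.rpow_sub hm0, le_div_iff₀ (by positivity)] at hmr
  linarith

end Limits

section Power

variable {Ω : ℕ → Type*} [∀ m, MeasurableSpace (Ω m)] {P : ∀ m, Measure (Ω m)}
  [∀ m, IsProbabilityMeasure (P m)] {n : ℕ → ℕ} {μ : ℕ → ℕ → ℝ} {X : ∀ m, ℕ → ℕ → Ω m → ℝ}
  {α γ d ε μ₁ : ℝ}

lemma tendsto_rejectProb_one (hn : ∀ m, 2 ≤ n m)
    (hX : ∀ m, IsGaussianSamples (P m) m (n m) (μ m) (X m)) (hα : 0 < α ∧ α < 1)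
    (hγ : 0 < γ ∧ γ ≤ 1) (hd : 0 ≤ d)
    (hlim : Tendsto (fun m : ℕ => Real.log (m : ℝ) / (n m : ℝ)) atTop (𝓝 d))
    (hsparse : (fun m : ℕ => (numFalse m (μ m) : ℝ)) =O[atTop] fun m : ℕ => (m : ℝ) ^ (1 - ε))
    (hμ : ∀ m, μ m 1 = μ₁) (hεγ : 1 ≤ ε + γ) (h1 : Real.exp (2 * γ * d) - 1 < μ₁ ^ 2)
    (h2 : 2 * ((1 - γ) * d) + 2 * √((1 - γ) * d) < μ₁ ^ 2) :
    Tendsto (fun m => rejectProb (P m) α γ m (n m) (X m) 1) atTop (𝓝 1) := by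
  have hN := tendsto_sampleSize hlim hn
  obtain ⟨a, ha1, haμ, ha⟩ := lt_rate_of_lt (mul_nonneg (by linarith) hd) h2
  -- An exponent slightly above `γ` turns the `O(m ^ γ)` expected count into at most `m ^ r`
  -- selections with high probability.
  obtain ⟨r, hr, hγr⟩ : ∃ r, Real.exp (2 * r * d) - 1 < μ₁ ^ 2 ∧ γ < r := by
    have hc : Continuous fun r : ℝ => Real.exp (2 * r * d) - 1 := by fun_prop
    have := (hc.continuousAt.eventually (gt_mem_nhds h1)).filter_mono
      (nhdsWithin_le_nhds (s := Set.Ioi γ))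
    exact (this.and self_mem_nhdsWithin).exists
  have hrd : 0 ≤ Real.exp (2 * r * d) - 1 := by
    rw [sub_nonneg, Real.one_le_exp_iff]
    have : 0 < r := by linarith
    positivity
  obtain ⟨z, hz1, hz2⟩ := exists_between hr
  have hz0 : 0 < z := by linarith
  have hz : √z ^ 2 = z := Real.sq_sqrt hz0.le
  have hthr := eventually_quantile_studentT_le hα hlim hn (r := r) (Real.sqrt_pos.2 hz0) (by
    rw [hz, Real.lt_log_iff_exp_lt (by linarith)]
    linarith)
  -- A neighbourhood of the limiting moments on which `H_1` passes both thresholds; `z` is the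
  -- squared critical value divided by `n - 1`.
  set U : Set (ℝ × ℝ) := {v | 0 < v.2 - v.1 ^ 2 ∧ z * (v.2 - v.1 ^ 2) < v.1 ^ 2 ∧ a < v.2} with hU
  have hUo : IsOpen U := by
    simp only [hU, Set.ofPred_and]
    exact (isOpen_lt (by fun_prop) (by fun_prop)).inter
      ((isOpen_lt (by fun_prop) (by fun_prop)).inter (isOpen_lt (by fun_prop) (by fun_prop)))
  have hUn : U ∈ 𝓝 (μ₁, 1 + μ₁ ^ 2) := hUo.mem_nhds ⟨by simp, by simpa using hz2, haμ⟩
  have hb1 := tendsto_measureReal_notMem hX hμ hN hUn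
  have hb2 := tendsto_measureReal_le_card_selected (r := r) hγr hεγ hn hX hsparse
  have hlow := (tendsto_const_nhds (x := (1 : ℝ))).sub (hb1.add hb2)
  rw [add_zero, sub_zero] at hlow
  refine tendsto_of_tendsto_of_tendsto_of_le_of_le' hlow tendsto_const_nhds ?_
    (Eventually.of_forall fun m => measureReal_le_one)
  filter_upwards [hthr, eventually_selThreshold_le hlim hn hγ.2 ha1 ha, eventually_ge_atTop 1]
    with m hm hsel hm1
  have hn0 : (0 : ℝ) < n m := by exact_mod_cast (by linarith [hn m] : 0 < n m)
  rw [sub_le_iff_le_add, ← probReal_univ (μ := P m), rejectProb]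
  refine (measureReal_mono fun ω _ => ?_).trans ((measureReal_union_le _ _).trans
    (add_le_add_right (measureReal_union_le _ _) _))
  by_contra hcon
  simp only [Set.mem_union, not_or, Set.mem_ofPred_eq, not_not, not_le] at hcon
  obtain ⟨hrej, ⟨hv, hT, hQ⟩, hcard⟩ := hcon
  have hmem : 1 ∈ selected γ m (n m) fun k j => X m k j ω := by
    rw [selected, Finset.mem_filter]
    refine ⟨by simpa using hm1, hsel.trans ?_⟩
    rw [← le_div_iff₀' hn0]
    exact hQ.le
  -- The count is at least `1` because `H_1` itself is selected.
  refine hrej ⟨hmem, (hm _ (Finset.card_pos.2 ⟨1, hmem⟩) hcard.le).trans ?_⟩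
  rw [sqrt_mul_le_abs_tStat_iff (hn m) (Real.sqrt_nonneg z) hv, hz]
  exact hT.le

lemma tendsto_rejectProb_zero_of_selection (hn : ∀ m, 2 ≤ n m)
    (hX : ∀ m, IsGaussianSamples (P m) m (n m) (μ m) (X m)) (hγ : γ ≤ 1) (hd : 0 ≤ d)
    (hlim : Tendsto (fun m : ℕ => Real.log (m : ℝ) / (n m : ℝ)) atTop (𝓝 d))
    (hμ : ∀ m, μ m 1 = μ₁) (h560 : (1 - γ) * d ≤ 560)
    (h : μ₁ ^ 2 < 2 * ((1 - γ) * d) + 1 / 4 * √((1 - γ) * d)) :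
    Tendsto (fun m => rejectProb (P m) α γ m (n m) (X m) 1) atTop (𝓝 0) := by
  obtain ⟨a, ha1, haμ, ha⟩ := rate_lt_of_lt (mul_nonneg (by linarith) hd) h560 h
  have hUn : {v : ℝ × ℝ | v.2 < a} ∈ 𝓝 (μ₁, 1 + μ₁ ^ 2) :=
    (isOpen_lt (by fun_prop) (by fun_prop)).mem_nhds haμ
  refine tendsto_of_tendsto_of_tendsto_of_le_of_le' tendsto_const_nhds
    (tendsto_measureReal_notMem hX hμ (tendsto_sampleSize hlim hn) hUn)
    (Eventually.of_forall fun m => measureReal_nonneg) ?_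
  filter_upwards [eventually_le_selThreshold hlim hn ha1 ha] with m hm
  have hn0 : (0 : ℝ) < n m := by exact_mod_cast (by linarith [hn m] : 0 < n m)
  refine measureReal_mono fun ω hω => ?_
  have hsel := (Finset.mem_filter.1 hω.1).2
  simp only [Set.mem_ofPred_eq, not_lt]
  rw [le_div_iff₀' hn0]
  exact hm.trans hsel

lemma tendsto_rejectProb_zero_of_detection (hn : ∀ m, 2 ≤ n m)
    (hX : ∀ m, IsGaussianSamples (P m) m (n m) (μ m) (X m)) (hα : 0 < α ∧ α < 1)
    (hγ : 0 < γ ∧ γ ≤ 1)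
    (hlim : Tendsto (fun m : ℕ => Real.log (m : ℝ) / (n m : ℝ)) atTop (𝓝 d)) (hε : 0 < ε)
    (hsparse : (fun m : ℕ => (numFalse m (μ m) : ℝ)) =O[atTop] fun m : ℕ => (m : ℝ) ^ (1 - ε))
    (hμ : ∀ m, μ m 1 = μ₁) (h : μ₁ ^ 2 < Real.exp (2 * γ * d) - 1) :
    Tendsto (fun m => rejectProb (P m) α γ m (n m) (X m) 1) atTop (𝓝 0) := by
  obtain ⟨z, hz1, hz2⟩ := exists_between h
  have hz0 : 0 < z := (sq_nonneg μ₁).trans_lt hz1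
  have hz : √z ^ 2 = z := Real.sq_sqrt hz0.le
  obtain ⟨r, hr, hrγ⟩ : ∃ r, Real.log (1 + z) < 2 * r * d ∧ r < γ := by
    have hc : Continuous fun r : ℝ => 2 * r * d := by fun_prop
    have h0 : Real.log (1 + z) < 2 * γ * d := by
      rw [Real.log_lt_iff_lt_exp (by linarith)]
      linarith
    have := (hc.continuousAt.eventually (lt_mem_nhds h0)).filter_mono
      (nhdsWithin_le_nhds (s := Set.Iio γ))
    exact (this.and self_mem_nhdsWithin).exists
  have hthr := eventually_le_quantile_studentT hα hlim hn (r := r) (Real.sqrt_pos.2 hz0)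
    (by rwa [hz])
  -- Near the limiting moments the `t`-statistic stays below its critical value, whether or not
  -- `H_1` is selected.
  set U : Set (ℝ × ℝ) := {v | 0 < v.2 - v.1 ^ 2 ∧ v.1 ^ 2 < z * (v.2 - v.1 ^ 2)} with hU
  have hUo : IsOpen U := by
    simp only [hU, Set.ofPred_and]
    exact (isOpen_lt (by fun_prop) (by fun_prop)).inter (isOpen_lt (by fun_prop) (by fun_prop))
  have hUn : U ∈ 𝓝 (μ₁, 1 + μ₁ ^ 2) := hUo.mem_nhds ⟨by simp, by simpa using hz1⟩
  have hup := (tendsto_measureReal_notMem hX hμ (tendsto_sampleSize hlim hn) hUn).add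
    (tendsto_measureReal_card_selected_lt hγ.1 hγ.2 hrγ hε hX hsparse)
  rw [add_zero] at hup
  refine tendsto_of_tendsto_of_tendsto_of_le_of_le' tendsto_const_nhds hup
    (Eventually.of_forall fun m => measureReal_nonneg) ?_
  filter_upwards [hthr] with m hm
  refine (measureReal_mono fun ω hω => ?_).trans (measureReal_union_le _ _)
  by_contra hcon
  simp only [Set.mem_union, not_or, Set.mem_ofPred_eq, not_not, not_lt] at hcon
  obtain ⟨⟨hv, hT⟩, hcard⟩ := hcon
  have := (hm _ hcard).trans hω.2
  rw [sqrt_mul_le_abs_tStat_iff (hn m) (Real.sqrt_nonneg z) hv, hz] at this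
  exact absurd hT (not_lt.2 this)

end Power

end TwoStage

theorem theorem3p1
    {Ω : ℕ → Type*} [∀ m, MeasurableSpace (Ω m)]
    (P : ∀ m, Measure (Ω m)) [∀ m, IsProbabilityMeasure (P m)]
    (n : ℕ → ℕ) (hn : ∀ m, 2 ≤ n m)
    (μ : ℕ → ℕ → ℝ) (X : ∀ m, ℕ → ℕ → Ω m → ℝ)
    (hX : ∀ m, TwoStage.IsGaussianSamples (P m) m (n m) (μ m) (X m))
    (α : ℝ) (hα : 0 < α ∧ α < 1)
    (γ : ℝ) (hγ : 0 < γ ∧ γ ≤ 1)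
    -- the limiting ratio of `log m` and the sample size
    (d : ℝ) (hd : 0 ≤ d)
    (hlim : Tendsto (fun m : ℕ => Real.log (m : ℝ) / (n m : ℝ)) atTop (𝓝 d))
    -- sparsity
    (ε : ℝ) (hε : 0 < ε ∧ ε ≤ 1)
    (hsparse : (fun m : ℕ => (TwoStage.numFalse m (μ m) : ℝ)) =Θ[atTop]
      fun m : ℕ => (m : ℝ) ^ (1 - ε))
    -- `H_1` is false, with a mean that does not depend on `m`
    (μ₁ : ℝ) (hμ₁ : μ₁ ≠ 0) (hμ : ∀ m, μ m 1 = μ₁) :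
    (1 ≤ ε + γ →
      max (Real.exp (2 * γ * d) - 1) (2 * (1 - γ) * d + 2 * √((1 - γ) * d)) < μ₁ ^ 2 →
      Tendsto (fun m => TwoStage.rejectProb (P m) α γ m (n m) (X m) 1) atTop (𝓝 1)) ∧
    (((1 - γ) * d ≤ 560 ∨ μ₁ ^ 2 < Real.exp (2 * γ * d) - 1) →
      μ₁ ^ 2 < max (Real.exp (2 * γ * d) - 1) (2 * (1 - γ) * d + 1 / 4 * √((1 - γ) * d)) →
      Tendsto (fun m => TwoStage.rejectProb (P m) α γ m (n m) (X m) 1) atTop (𝓝 0)) := by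
  refine ⟨fun hεγ h => ?_, fun h560 h => ?_⟩
  · rw [max_lt_iff] at h
    exact TwoStage.tendsto_rejectProb_one hn hX hα hγ hd hlim hsparse.1 hμ hεγ h.1
      (by linarith [h.2])
  · by_cases hdet : μ₁ ^ 2 < Real.exp (2 * γ * d) - 1
    · exact TwoStage.tendsto_rejectProb_zero_of_detection hn hX hα hγ hlim hε.1 hsparse.1 hμ hdet
    · have hsel := (lt_max_iff.1 h).resolve_left hdet
      exact TwoStage.tendsto_rejectProb_zero_of_selection hn hX hγ.2 hd hlim hμ
        (h560.resolve_right hdet) (by linarith)
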